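/- Let $n\ge 1$ and $d=2^n$. Let $\Omega=iY\otimes \mathbb{1}^{\otimes (n-1)}$ be the canonical symplectic form on $(\mathbb{C}^2)^{\otimes n}$, where $Y$ is the Pauli matrix, and let $$\mathbb{SP}(d/2)=\{S\in \mathbb{U}(d) : S^T\Omega S=\Omega\}$$ be the compact symplectic group. Let $\mu$ be either the Haar probability measure $\mu_H$ on $\mathbb{SP}(d/2)$ or a $2$-design over $\mathbb{SP}(d/2)$, i.e. a Borel probability measure on $\mathbb{SP}(d/2)$ such that $$\int U^{\otimes 2}X(U^\dagger)^{\otimes 2}\,d\mu(U)=\int U^{\otimes 2}X(U^\dagger)^{\otimes 2}\,d\mu_H(U)$$ for every linear operator $X$ on $((\mathbb{C}^2)^{\otimes n})^{\otimes 2}$. Then, for every $x\in\{0,1\}^n$ and every real $\alpha$ with $0\le\alpha\le 1$, $$\Pr_{U\sim\mu}\left(\left|\langle x|U|0\rangle^{\otimes n}\right|^2\ge\frac{\alpha}{d}\right)\ge\frac{(1-\alpha)^2}{2}.$$ -/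

import Mathlib

open MeasureTheory Matrix
open scoped Matrix

noncomputable section

namespace SymplecticCircuits

/-- The tensor (Kronecker) product `A 0 ⊗ A 1 ⊗ ⋯ ⊗ A (k - 1)` of `k` square matrices, with rows and
columns indexed by `k`-tuples. -/
def tensor {ι : Type} {k : ℕ} (A : Fin k → Matrix ι ι ℂ) :
    Matrix (Fin k → ι) (Fin k → ι) ℂ :=
  Matrix.of fun x y => ∏ i, A i (x i) (y i)

/-- The `t`-fold tensor power `A ⊗ ⋯ ⊗ A`. -/
def tensorPow {ι : Type} (t : ℕ) (A : Matrix ι ι ℂ) : Matrix (Fin t → ι) (Fin t → ι) ℂ :=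
  tensor fun _ => A

/-- Bit strings of length `n`; they label the computational basis of `(ℂ²)^{⊗ n}`. -/
abbrev Bits (n : ℕ) : Type := Fin n → Fin 2

/-- The Pauli matrix `Y`. -/
def pauliY : Matrix (Fin 2) (Fin 2) ℂ := !![0, -Complex.I; Complex.I, 0]

/-- The canonical symplectic form `Ω = iY ⊗ 1 ⊗ ⋯ ⊗ 1` on `n` qubits. -/
def Omega (n : ℕ) : Matrix (Bits n) (Bits n) ℂ :=
  tensor fun i => if i.val = 0 then Complex.I • pauliY else 1

/-- The compact symplectic group `𝕊ℙ(d/2)` with `d = 2 ^ n`: the unitary `d × d` matrices `S` with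
`Sᵀ Ω S = Ω`. -/
def SP (n : ℕ) : Subgroup (Matrix.unitaryGroup (Bits n) ℂ) where
  carrier := {S | (S : Matrix (Bits n) (Bits n) ℂ)ᵀ * Omega n * S = Omega n}
  one_mem' := by simp
  mul_mem' := by
    intro a b ha hb
    simp only [Set.mem_ofPred_eq, Submonoid.coe_mul, Matrix.transpose_mul] at *
    calc _ = (b : Matrix (Bits n) (Bits n) ℂ)ᵀ *
          ((a : Matrix (Bits n) (Bits n) ℂ)ᵀ * Omega n * a) * b := by
            simp only [Matrix.mul_assoc]
      _ = _ := by rw [ha, hb]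
  inv_mem' := by
    intro a ha
    simp only [Set.mem_ofPred_eq] at *
    have h1 : (a : Matrix (Bits n) (Bits n) ℂ) * ((a⁻¹ : Matrix.unitaryGroup (Bits n) ℂ) :
        Matrix (Bits n) (Bits n) ℂ) = 1 := by
      rw [← Submonoid.coe_mul, mul_inv_cancel, Submonoid.coe_one]
    have h2 := congrArg Matrix.transpose h1
    rw [Matrix.transpose_mul, Matrix.transpose_one] at h2
    conv_lhs => rw [← ha]
    simp only [Matrix.mul_assoc]
    rw [h1, Matrix.mul_one, ← Matrix.mul_assoc, h2, Matrix.one_mul]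

/-- The matrix of an element of the symplectic group. -/
def toMat {n : ℕ} (U : SP n) : Matrix (Bits n) (Bits n) ℂ := U.1.1

lemma isClosedEmbedding_toMat (n : ℕ) : Topology.IsClosedEmbedding (toMat (n := n)) := by
  refine ⟨Topology.IsEmbedding.subtypeVal.comp Topology.IsEmbedding.subtypeVal, ?_⟩
  have h : Set.range (toMat (n := n)) =
      {A | star A * A = 1} ∩ {A | A * star A = 1} ∩ {A | Aᵀ * Omega n * A = Omega n} := by
    ext A
    constructor
    · rintro ⟨U, rfl⟩
      exact ⟨⟨U.1.2.1, U.1.2.2⟩, U.2⟩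
    · rintro ⟨⟨h1, h2⟩, h3⟩
      exact ⟨⟨⟨A, ⟨h1, h2⟩⟩, h3⟩, rfl⟩
  rw [h]
  refine ((isClosed_eq ?_ ?_).inter (isClosed_eq ?_ ?_)).inter (isClosed_eq ?_ ?_) <;> fun_prop

/-- The symplectic group `𝕊ℙ(d/2)` is compact. -/
instance (n : ℕ) : CompactSpace (SP n) := by
  have hK : IsCompact {A : Matrix (Bits n) (Bits n) ℂ |
      ∀ i, A i ∈ {v : Bits n → ℂ | ∀ j, v j ∈ Metric.closedBall (0 : ℂ) 1}} :=
    isCompact_pi_infinite fun _ => isCompact_pi_infinite fun _ => isCompact_closedBall 0 1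
  refine ⟨?_⟩
  rw [(isClosedEmbedding_toMat n).isEmbedding.isCompact_iff]
  rw [Set.image_univ]
  refine hK.of_isClosed_subset (isClosedEmbedding_toMat n).isClosed_range ?_
  rintro _ ⟨U, rfl⟩ i j
  simpa [toMat] using entry_norm_bound_of_unitary U.1.2 i j

/-- The Borel `σ`-algebra of the symplectic group. -/
instance (n : ℕ) : MeasurableSpace (SP n) := borel _

instance (n : ℕ) : BorelSpace (SP n) := ⟨rfl⟩

/-- The Haar measure on `𝕊ℙ(d/2)`, normalized to total mass one. -/
def haar (n : ℕ) : Measure (SP n) := Measure.haarMeasure ⊤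

/-- The `t`-fold twirl `∫ U^{⊗t} X (U†)^{⊗t} dμ(U)` of `X`; the integral of a matrix-valued function
is taken entrywise. -/
def twirl {n : ℕ} (t : ℕ) (μ : Measure (SP n))
    (X : Matrix (Fin t → Bits n) (Fin t → Bits n) ℂ) :
    Matrix (Fin t → Bits n) (Fin t → Bits n) ℂ :=
  Matrix.of fun a b => ∫ U, (tensorPow t (toMat U) * X * tensorPow t (toMat U)ᴴ) a b ∂μ

/-- `μ` is a `t`-design over `𝕊ℙ(d/2)`: a probability measure on `𝕊ℙ(d/2)` whose `t`-fold twirl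
agrees with that of the Haar measure. -/
structure IsDesign {n : ℕ} (t : ℕ) (μ : Measure (SP n)) : Prop where
  isProbabilityMeasure : IsProbabilityMeasure μ
  twirl_eq : ∀ X, twirl t μ X = twirl t (haar n) X

/-- The probability `|⟨x|U|0⟩^{⊗n}|²` of the outcome `x` when `U|0⟩^{⊗n}` is measured in the
computational basis. -/
def outputProb {n : ℕ} (U : SP n) (x : Bits n) : ℝ := ‖toMat U x 0‖ ^ 2

end SymplecticCircuits

end

/-!
With `d = 2 ^ n` and `p U = |⟨x|U|0⟩|²`, the bound is the Paley–Zygmund inequality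
`P(p ≥ α E p) ≥ (1 - α)² (E p)² / E p²` (`paley_zygmund`), applied with `E p = 1 / d` and
`E p² ≤ 2 / d²`. Both moments are entries of twofold twirls, of `|0⟩⟨0| ⊗ 1` and of
`|0⟩⟨0| ⊗ |0⟩⟨0|` (`IsDesign.integral_outputProb`, `IsDesign.integral_outputProb_sq`), so it suffices
to compute them for the Haar measure.

There, no representation theory is needed. By left invariance the law of `⟨w, U e_0⟩` is that of
`⟨e_x, U e_0⟩` whenever some symplectic matrix maps `e_x` to `w` (`integral_column_eq`). Such
matrices are supplied by `Ω` itself and by quaternionic reflections, which fix the complement of the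
quaternionic line spanned by a vector `u` and `Ω ū` (`exists_mulVec_single`). Taking for `w` the
basis vectors shows that all entries of the column `U e_0` have the same moments, and `∑ |U_{y0}|² = 1`
gives `E p = 1 / d`. Taking `w = (e_x + c e_y) / √2` for the four phases `c = ±1, ±i` gives
`E |U_{x0}|² |U_{y0}|² = E p² / 2` for all `y` other than `x` and the index `partner x` with
`Ω e_x = ± e_{partner x}`. Summing over `y` and discarding the nonnegative term of `partner x`
leaves `d E p² / 2 ≤ E p = 1 / d`, which is the required `E p² ≤ 2 / d²`
(`integral_norm_pow_four_le`).
-/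

namespace SymplecticCircuits

/-! ### The symplectic form -/

/-- The bit string `x` with its first bit flipped: `Ω` maps `e_x` to `± e_{partner x}`. -/
def partner {m : ℕ} (x : Bits (m + 1)) : Bits (m + 1) := Function.update x 0 (1 - x 0)

/-- The sign of the nonzero entry of `Ω` in row `x`. -/
def omegaSign {m : ℕ} (x : Bits (m + 1)) : ℂ := if x 0 = 0 then 1 else -1

lemma partner_partner {m : ℕ} (x : Bits (m + 1)) : partner (partner x) = x := by
  simp [partner]

lemma partner_ne {m : ℕ} (x : Bits (m + 1)) : partner x ≠ x := by
  intro h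
  have h0 := congrFun h 0
  simp only [partner, Function.update_self] at h0
  revert h0
  generalize x 0 = b
  fin_cases b <;> simp

lemma omegaSign_partner {m : ℕ} (x : Bits (m + 1)) : omegaSign (partner x) = -omegaSign x := by
  simp only [omegaSign, partner, Function.update_self]
  generalize x 0 = b
  fin_cases b <;> simp

lemma Omega_apply {m : ℕ} (x y : Bits (m + 1)) :
    Omega (m + 1) x y = if y = partner x then omegaSign x else 0 := by
  have h : Omega (m + 1) x y =
      (Complex.I • pauliY) (x 0) (y 0) * ∏ i : Fin m, (1 : Matrix _ _ ℂ) (x i.succ) (y i.succ) := by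
    simp [Omega, tensor, Fin.prod_univ_succ]
  have hp : y = partner x ↔ y 0 = 1 - x 0 ∧ ∀ i : Fin m, x i.succ = y i.succ := by
    rw [funext_iff, Fin.forall_fin_succ]
    simp [partner, eq_comm]
  have h1 : ∏ i : Fin m, (1 : Matrix (Fin 2) (Fin 2) ℂ) (x i.succ) (y i.succ) =
      if ∀ i : Fin m, x i.succ = y i.succ then 1 else 0 := by
    simp [Matrix.one_apply, Finset.prod_ite_zero]
  rw [h, h1]
  by_cases hr : ∀ i : Fin m, x i.succ = y i.succ
  · simp only [hp, hr, omegaSign, pauliY]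
    generalize x 0 = a
    generalize y 0 = b
    fin_cases a <;> fin_cases b <;> simp
  · simp [hp, hr]

lemma Omega_mulVec {m : ℕ} (v : Bits (m + 1) → ℂ) (x : Bits (m + 1)) :
    (Omega (m + 1) *ᵥ v) x = omegaSign x * v (partner x) := by
  simp [Matrix.mulVec, dotProduct, Omega_apply]

lemma Omega_transpose (m : ℕ) : (Omega (m + 1))ᵀ = -Omega (m + 1) := by
  ext x y
  rw [Matrix.transpose_apply, Matrix.neg_apply, Omega_apply, Omega_apply]
  by_cases h : y = partner x
  · subst h
    simp [partner_partner, omegaSign_partner]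
  · have : x ≠ partner y := fun h' => h (by rw [h', partner_partner])
    simp [h, this]

lemma Omega_map_star (m : ℕ) : (Omega (m + 1)).map star = Omega (m + 1) := by
  ext x y
  simp only [Matrix.map_apply, Omega_apply, omegaSign]
  split_ifs <;> simp

lemma Omega_mul_self (m : ℕ) : Omega (m + 1) * Omega (m + 1) = -1 := by
  ext x y
  have h : (Omega (m + 1) * Omega (m + 1)) x y = omegaSign x * Omega (m + 1) (partner x) y :=
    Omega_mulVec (fun i => Omega (m + 1) i y) x
  rw [h, Omega_apply, partner_partner, omegaSign_partner]
  by_cases hxy : x = y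
  · subst hxy
    simp only [omegaSign, if_true, Matrix.neg_apply, Matrix.one_apply_eq]
    split_ifs <;> simp
  · simp [Ne.symm hxy, hxy]

lemma norm_omegaSign {m : ℕ} (x : Bits (m + 1)) : ‖omegaSign x‖ = 1 := by
  unfold omegaSign
  split_ifs <;> simp

/-! ### Elements of the symplectic group -/

/-- A matrix that is unitary and commutes with the antiunitary map `v ↦ Ω v̄` is symplectic. -/
def mkSP {m : ℕ} (S : Matrix (Bits (m + 1)) (Bits (m + 1)) ℂ) (hS : Sᴴ * S = 1)
    (hJ : Omega (m + 1) * S = S.map star * Omega (m + 1)) : SP (m + 1) :=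
  ⟨⟨S, Matrix.mem_unitaryGroup_iff'.2 hS⟩, by
    change Sᵀ * Omega (m + 1) * S = Omega (m + 1)
    have h : Sᵀ * S.map star = 1 := by
      have := congrArg (fun M => M.map star) hS
      simpa [Matrix.map_mul, Matrix.conjTranspose, Matrix.map_map, Function.comp_def,
        ← starRingEnd_apply] using this
    rw [Matrix.mul_assoc, hJ, ← Matrix.mul_assoc, h, Matrix.one_mul]⟩

lemma toMat_mkSP {m : ℕ} (S : Matrix (Bits (m + 1)) (Bits (m + 1)) ℂ) (hS : Sᴴ * S = 1)
    (hJ : Omega (m + 1) * S = S.map star * Omega (m + 1)) : toMat (mkSP S hS hJ) = S := rfl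

/-- The orthogonal projection, scaled by `‖u‖²`, onto the quaternionic line spanned by `u` and
`Ω ū`. -/
def lineProj {m : ℕ} (u : Bits (m + 1) → ℂ) : Matrix (Bits (m + 1)) (Bits (m + 1)) ℂ :=
  vecMulVec u (star u) + vecMulVec (Omega (m + 1) *ᵥ star u) (Omega (m + 1) *ᵥ u)

lemma star_Omega_mulVec {m : ℕ} (u : Bits (m + 1) → ℂ) :
    star (Omega (m + 1) *ᵥ u) = Omega (m + 1) *ᵥ star u := by
  ext x
  simp only [Pi.star_apply, Omega_mulVec, star_mul', omegaSign]
  split_ifs <;> simp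

lemma lineProj_conjTranspose {m : ℕ} (u : Bits (m + 1) → ℂ) : (lineProj u)ᴴ = lineProj u := by
  simp [lineProj, conjTranspose_add, conjTranspose_vecMulVec, star_Omega_mulVec]

lemma Omega_mulVec_mulVec {m : ℕ} (u : Bits (m + 1) → ℂ) :
    Omega (m + 1) *ᵥ (Omega (m + 1) *ᵥ u) = -u := by
  rw [Matrix.mulVec_mulVec, Omega_mul_self, Matrix.neg_mulVec, Matrix.one_mulVec]

lemma vecMul_Omega {m : ℕ} (u : Bits (m + 1) → ℂ) :
    u ᵥ* Omega (m + 1) = -(Omega (m + 1) *ᵥ u) := by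
  rw [← Matrix.mulVec_transpose, Omega_transpose, Matrix.neg_mulVec]

lemma Omega_mulVec_dotProduct {m : ℕ} (u v : Bits (m + 1) → ℂ) :
    (Omega (m + 1) *ᵥ u) ⬝ᵥ v = -(u ⬝ᵥ (Omega (m + 1) *ᵥ v)) := by
  rw [Matrix.dotProduct_mulVec, vecMul_Omega, neg_dotProduct, neg_neg]

lemma dotProduct_Omega_mulVec_self {m : ℕ} (u : Bits (m + 1) → ℂ) :
    u ⬝ᵥ (Omega (m + 1) *ᵥ u) = 0 := by
  have h := Omega_mulVec_dotProduct u u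
  rw [dotProduct_comm] at h
  exact self_eq_neg.1 h

lemma lineProj_mul_self {m : ℕ} (u : Bits (m + 1) → ℂ) :
    lineProj u * lineProj u = (star u ⬝ᵥ u) • lineProj u := by
  have h1 : (Omega (m + 1) *ᵥ u) ⬝ᵥ (Omega (m + 1) *ᵥ star u) = star u ⬝ᵥ u := by
    rw [Omega_mulVec_dotProduct, Omega_mulVec_mulVec, dotProduct_neg, neg_neg, dotProduct_comm]
  have h2 : (Omega (m + 1) *ᵥ u) ⬝ᵥ u = 0 := by
    rw [dotProduct_comm, dotProduct_Omega_mulVec_self]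
  simp [lineProj, Matrix.add_mul, Matrix.mul_add, vecMulVec_mul_vecMulVec, h1, h2,
    dotProduct_Omega_mulVec_self, smul_add]

lemma Omega_mul_lineProj {m : ℕ} (u : Bits (m + 1) → ℂ) :
    Omega (m + 1) * lineProj u = (lineProj u).map star * Omega (m + 1) := by
  have h : ∀ a b : Bits (m + 1) → ℂ, (vecMulVec a b).map star = vecMulVec (star a) (star b) := by
    intro a b
    ext i j
    simp [vecMulVec_apply]
  rw [lineProj, Matrix.map_add _ (fun a b => star_add a b), h, h]
  simp only [Matrix.mul_add, Matrix.add_mul, mul_vecMulVec, vecMulVec_mul, vecMul_Omega,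
    Omega_mulVec_mulVec, star_Omega_mulVec, star_star, vecMulVec_neg, neg_vecMulVec, neg_neg]
  exact add_comm _ _

/-- The quaternionic reflection `1 - (2 / ‖u‖²) P`, with `P` the scaled projection onto the
quaternionic line of `u`; the scalar `c = 2 / ‖u‖²` is a parameter. -/
lemma exists_toMat_eq_reflection {m : ℕ} (u : Bits (m + 1) → ℂ) (c : ℝ)
    (hc : (c : ℂ) * (star u ⬝ᵥ u) = 2) :
    ∃ S : SP (m + 1), toMat S = 1 - (c : ℂ) • lineProj u := by
  refine ⟨mkSP (1 - (c : ℂ) • lineProj u) ?_ ?_, toMat_mkSP _ _ _⟩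
  · have : (c : ℂ) • (c : ℂ) • (star u ⬝ᵥ u) • lineProj u = (2 * c : ℂ) • lineProj u := by
      rw [smul_smul, smul_smul, ← hc]
      congr 1
      ring
    simp only [conjTranspose_sub, conjTranspose_one, conjTranspose_smul, lineProj_conjTranspose,
      RCLike.star_def, Complex.conj_ofReal, Matrix.sub_mul, Matrix.mul_sub, Matrix.one_mul,
      Matrix.mul_one, Matrix.smul_mul, Matrix.mul_smul, smul_sub, lineProj_mul_self]
    rw [this, two_mul, add_smul]
    abel
  · have : (1 - (c : ℂ) • lineProj u).map star = 1 - (c : ℂ) • (lineProj u).map star := by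
      ext i j
      simp [Matrix.one_apply, apply_ite]
    rw [this, Matrix.mul_sub, Matrix.sub_mul, Matrix.mul_one, Matrix.one_mul, Matrix.mul_smul,
      Matrix.smul_mul, Omega_mul_lineProj]

/-- The symplectic group moves `e_x` to every unit vector `w` (other than `e_x`) whose inner product
with `e_x` is real and which is orthogonal to `Ω e_x`. -/
lemma exists_mulVec_single {m : ℕ} (x : Bits (m + 1)) (w : Bits (m + 1) → ℂ)
    (hw : star w ⬝ᵥ w = 1) (r : ℝ) (hr : w x = r) (hr1 : r ≠ 1) (hx : w (partner x) = 0) :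
    ∃ S : SP (m + 1), ∀ i, toMat S i x = w i := by
  have h1 : (1 - r : ℂ) ≠ 0 := by
    exact_mod_cast sub_ne_zero.2 hr1.symm
  -- The quaternionic reflection along `e_x - w`, where `‖e_x - w‖² = 2 (1 - r)`.
  obtain ⟨S, hS⟩ := exists_toMat_eq_reflection (Pi.single x 1 - w) (1 - r)⁻¹ (by
    have : star (Pi.single x 1 - w) ⬝ᵥ (Pi.single x 1 - w) = (2 * (1 - r) : ℂ) := by
      simp only [star_sub, sub_dotProduct, dotProduct_sub, hw, Pi.star_single, star_one]
      simp [hr]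
      ring
    rw [this]
    push_cast
    field_simp)
  refine ⟨S, fun i => ?_⟩
  have h2 : lineProj (Pi.single x 1 - w) i x =
      (Pi.single x 1 - w : Bits (m + 1) → ℂ) i * (1 - r) := by
    simp [lineProj, vecMulVec_apply, Omega_mulVec, hr, hx, partner_ne]
  rw [hS, Matrix.sub_apply, Matrix.smul_apply, h2]
  push_cast
  rw [smul_eq_mul, mul_comm _ (1 - r : ℂ), inv_mul_cancel_left₀ h1]
  simp [Matrix.one_apply, Pi.single_apply]

lemma exists_toMat_eq_Omega (m : ℕ) : ∃ S : SP (m + 1), toMat S = Omega (m + 1) := by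
  refine ⟨mkSP (Omega (m + 1)) ?_ (by rw [Omega_map_star]), toMat_mkSP _ _ _⟩
  rw [conjTranspose, Omega_transpose, Matrix.map_neg _ (fun a => star_neg a), Omega_map_star,
    Matrix.neg_mul, Omega_mul_self, neg_neg]

/-! ### Moments of a matrix entry under the Haar measure -/

instance (n : ℕ) : IsProbabilityMeasure (haar n) :=
  ⟨Measure.haarMeasure_self (K₀ := (⊤ : TopologicalSpace.PositiveCompacts (SP n)))⟩

lemma continuous_toMat_apply {n : ℕ} (x y : Bits n) : Continuous fun U : SP n => toMat U x y :=
  (continuous_apply_apply x y).comp (isClosedEmbedding_toMat n).continuous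

/-- Continuous functions on the compact group are integrable. -/
lemma integrable_of_continuous {n : ℕ} (μ : Measure (SP n)) [IsFiniteMeasure μ] {E : Type*}
    [NormedAddCommGroup E] {f : SP n → E} (hf : Continuous f) : Integrable f μ :=
  hf.integrable_of_hasCompactSupport (HasCompactSupport.of_compactSpace f)

/-- Under the Haar measure `⟨w, U e_0⟩` and `⟨e_x, U e_0⟩` have the same distribution when some
symplectic matrix maps `e_x` to `w`. -/
lemma integral_column_eq {n : ℕ} (f : ℂ → ℝ) (S : SP n) (x : Bits n) :
    ∫ U, f (∑ i, star (toMat S i x) * toMat U i 0) ∂haar n = ∫ U, f (toMat U x 0) ∂haar n := by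
  have : (haar n).IsMulLeftInvariant := by unfold haar; infer_instance
  rw [← integral_mul_left_eq_self (fun U => f (toMat U x 0)) S⁻¹]
  rfl

lemma integral_norm_pow_eq {m : ℕ} (k : ℕ) (x y : Bits (m + 1)) :
    ∫ U, ‖toMat U y 0‖ ^ k ∂haar (m + 1) = ∫ U, ‖toMat U x 0‖ ^ k ∂haar (m + 1) := by
  by_cases hyx : y = x
  · rw [hyx]
  by_cases hp : y = partner x
  · obtain ⟨S, hS⟩ := exists_toMat_eq_Omega m
    rw [← integral_column_eq (fun z => ‖z‖ ^ k) S x]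
    have h (U : SP (m + 1)) : ∑ i, star (toMat S i x) * toMat U i 0 =
        star (omegaSign y) * toMat U y 0 := by
      rw [Finset.sum_eq_single y]
      · simp [hS, Omega_apply, hp, partner_partner]
      · intro i _ hi
        have : x ≠ partner i := fun h' => hi (by rw [hp, h', partner_partner])
        simp [hS, Omega_apply, this]
      · simp
    simp only [h, norm_mul, norm_star, norm_omegaSign, one_mul]
  · obtain ⟨S, hS⟩ := exists_mulVec_single x (Pi.single y 1) (by simp [Pi.star_single])
      0 (by simp [Ne.symm hyx]) (by simp) (by simp [Ne.symm hp])
    rw [← integral_column_eq (fun z => ‖z‖ ^ k) S x]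
    simp [hS, Pi.single_apply]

lemma sum_norm_sq {n : ℕ} (U : SP n) (y : Bits n) : ∑ x, ‖toMat U x y‖ ^ 2 = 1 := by
  have h := congrFun (congrFun (Matrix.mem_unitaryGroup_iff'.1 U.1.2) y) y
  rw [Matrix.mul_apply, Matrix.one_apply_eq] at h
  have h' : ∀ x, (star (U.1.1) y x * U.1.1 x y : ℂ) = ((‖toMat U x y‖ ^ 2 : ℝ) : ℂ) := by
    intro x
    rw [Matrix.star_apply, RCLike.star_def, Complex.conj_mul']
    push_cast
    rfl
  simp only [h'] at h
  exact_mod_cast h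

lemma integral_norm_sq {m : ℕ} (x : Bits (m + 1)) :
    ∫ U, ‖toMat U x 0‖ ^ 2 ∂haar (m + 1) = 1 / 2 ^ (m + 1) := by
  have h : ∑ y : Bits (m + 1), ∫ U, ‖toMat U y 0‖ ^ 2 ∂haar (m + 1) = 1 := by
    rw [← integral_finsetSum]
    · simp [sum_norm_sq]
    · exact fun y _ => integrable_of_continuous _ ((continuous_toMat_apply y 0).norm.pow 2)
  simp only [integral_norm_pow_eq 2 x, Finset.sum_const, Finset.card_univ, Fintype.card_pi,
    Fintype.card_fin, Finset.prod_const, nsmul_eq_mul] at h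
  rw [eq_div_iff (by positivity), mul_comm]
  simpa using h

/-- Averaging over the phases `1, -1, i, -i` kills all mixed terms of `|a + c b|⁴` but
`4 |a|² |b|²`. -/
lemma sum_phases_norm_pow_four (a b : ℂ) :
    ‖a + b‖ ^ 4 + ‖a - b‖ ^ 4 + ‖a + Complex.I * b‖ ^ 4 + ‖a - Complex.I * b‖ ^ 4 =
      4 * (‖a‖ ^ 4 + ‖b‖ ^ 4 + 4 * (‖a‖ ^ 2 * ‖b‖ ^ 2)) := by
  have h : ∀ z : ℂ, ‖z‖ ^ 4 = (z.re ^ 2 + z.im ^ 2) ^ 2 := by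
    intro z
    rw [show 4 = 2 * 2 from rfl, pow_mul, ← Complex.normSq_eq_norm_sq, Complex.normSq_apply]
    ring
  have h2 : ∀ z : ℂ, ‖z‖ ^ 2 = z.re ^ 2 + z.im ^ 2 := by
    intro z
    rw [← Complex.normSq_eq_norm_sq, Complex.normSq_apply]
    ring
  simp only [h, h2, Complex.add_re, Complex.add_im, Complex.sub_re, Complex.sub_im,
    Complex.mul_re, Complex.mul_im, Complex.I_re, Complex.I_im]
  ring

/-- Invariance under a symplectic matrix mapping `e_x` to `(e_x + c̄ e_y) / √2`. -/
lemma integral_norm_add_pow_four {m : ℕ} {x y : Bits (m + 1)} (hyx : y ≠ x) (hp : y ≠ partner x)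
    (c : ℂ) (hc : ‖c‖ = 1) :
    ∫ U, ‖toMat U x 0 + c * toMat U y 0‖ ^ 4 ∂haar (m + 1) =
      4 * ∫ U, ‖toMat U x 0‖ ^ 4 ∂haar (m + 1) := by
  have hs : (√2 : ℝ)⁻¹ * (√2)⁻¹ = 1 / 2 := by
    rw [← mul_inv, Real.mul_self_sqrt (by norm_num)]
    norm_num
  have hsC : ((√2 : ℝ) : ℂ)⁻¹ * ((√2 : ℝ) : ℂ)⁻¹ = 1 / 2 := by
    rw [← Complex.ofReal_inv, ← Complex.ofReal_mul, hs]
    norm_num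
  have hcc : c * (starRingEnd ℂ) c = 1 := by rw [Complex.mul_conj']; simp [hc]
  obtain ⟨S, hS⟩ := exists_mulVec_single x
    (((√2 : ℝ)⁻¹ : ℂ) • (Pi.single x 1 + Pi.single y (star c))) (by
      simp only [star_smul, star_add, Pi.star_single, star_one, star_star, smul_dotProduct,
        dotProduct_smul, add_dotProduct, dotProduct_add]
      simp [hyx, Ne.symm hyx, hcc]
      linear_combination 2 * hsC)
    (√2)⁻¹ (by simp [Ne.symm hyx]) (by
      intro h
      rw [h] at hs
      norm_num at hs)
    (by simp [partner_ne, Ne.symm hp])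
  rw [← integral_column_eq (fun z => ‖z‖ ^ 4) S x, ← integral_const_mul]
  congr 1
  ext U
  have h : ∑ i, star (toMat S i x) * toMat U i 0 =
      ((√2 : ℝ)⁻¹ : ℂ) * (toMat U x 0 + c * toMat U y 0) := by
    have hi (i : Bits (m + 1)) : star (toMat S i x) * toMat U i 0 = ((√2 : ℝ)⁻¹ : ℂ) *
        ((if i = x then toMat U i 0 else 0) + if i = y then c * toMat U i 0 else 0) := by
      rw [hS]
      by_cases hx : i = x
      · subst hx
        simp [Ne.symm hyx]
      by_cases hy : i = y
      · subst hy
        simp [hx, mul_assoc]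
      · simp [hx, hy]
    rw [Finset.sum_congr rfl fun i _ => hi i, ← Finset.mul_sum, Finset.sum_add_distrib]
    simp
  have h4 : (|√2|⁻¹ : ℝ) ^ 4 = 1 / 4 := by
    rw [abs_of_nonneg (Real.sqrt_nonneg 2), show 4 = 2 * 2 from rfl, pow_mul, sq (√2)⁻¹, hs]
    norm_num
  rw [h, norm_mul, mul_pow, norm_inv, Complex.norm_real, Real.norm_eq_abs, h4]
  ring

lemma integral_norm_sq_mul_norm_sq {m : ℕ} {x y : Bits (m + 1)} (hyx : y ≠ x)
    (hp : y ≠ partner x) :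
    ∫ U, ‖toMat U x 0‖ ^ 2 * ‖toMat U y 0‖ ^ 2 ∂haar (m + 1) =
      (∫ U, ‖toMat U x 0‖ ^ 4 ∂haar (m + 1)) / 2 := by
  have hx := continuous_toMat_apply (n := m + 1) x 0
  have hy := continuous_toMat_apply (n := m + 1) y 0
  have hi {f : SP (m + 1) → ℝ} (hf : Continuous f) := integrable_of_continuous (haar (m + 1)) hf
  have h : ∫ U, (‖toMat U x 0 + 1 * toMat U y 0‖ ^ 4 + ‖toMat U x 0 + (-1) * toMat U y 0‖ ^ 4
      + ‖toMat U x 0 + Complex.I * toMat U y 0‖ ^ 4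
      + ‖toMat U x 0 + (-Complex.I) * toMat U y 0‖ ^ 4) ∂haar (m + 1) =
      ∫ U, 4 * (‖toMat U x 0‖ ^ 4 + ‖toMat U y 0‖ ^ 4 +
        4 * (‖toMat U x 0‖ ^ 2 * ‖toMat U y 0‖ ^ 2)) ∂haar (m + 1) := by
    congr 1
    ext U
    rw [← sum_phases_norm_pow_four]
    simp [sub_eq_add_neg]
  rw [integral_add (hi (by fun_prop)) (hi (by fun_prop)),
    integral_add (hi (by fun_prop)) (hi (by fun_prop)),
    integral_add (hi (by fun_prop)) (hi (by fun_prop)), integral_const_mul,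
    integral_add (hi (by fun_prop)) (hi (by fun_prop)),
    integral_add (hi (by fun_prop)) (hi (by fun_prop)), integral_const_mul,
    integral_norm_add_pow_four hyx hp 1 (by simp), integral_norm_add_pow_four hyx hp (-1) (by simp),
    integral_norm_add_pow_four hyx hp Complex.I (by simp),
    integral_norm_add_pow_four hyx hp (-Complex.I) (by simp), integral_norm_pow_eq 4 x y] at h
  linarith

/-- The exact value is `2 / (d (d + 1))`; dropping the nonnegative correlation of the entries `x` and
`partner x` from `∑ y, E |U_{x0}|² |U_{y0}|² = E |U_{x0}|²` still gives `2 / d²`. -/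
lemma integral_norm_pow_four_le {m : ℕ} (x : Bits (m + 1)) :
    ∫ U, ‖toMat U x 0‖ ^ 4 ∂haar (m + 1) ≤ 2 / (2 ^ (m + 1)) ^ 2 := by
  set A := ∫ U, ‖toMat U x 0‖ ^ 4 ∂haar (m + 1)
  have hc : ∀ y : Bits (m + 1), Continuous fun U : SP (m + 1) => toMat U y 0 :=
    fun y => continuous_toMat_apply y 0
  have h1 : ∑ y, ∫ U, ‖toMat U x 0‖ ^ 2 * ‖toMat U y 0‖ ^ 2 ∂haar (m + 1) = 1 / 2 ^ (m + 1) := by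
    rw [← integral_finsetSum, ← integral_norm_sq x]
    · simp [← Finset.mul_sum, sum_norm_sq]
    · intro y _
      have := hc x
      have := hc y
      exact integrable_of_continuous _ (by fun_prop)
  -- `A / 2` is the term for generic `y`; the two corrections are for `y = x` and `y = partner x`.
  have h2 : ∀ y, A / 2 + (if y = x then A / 2 else 0) - (if y = partner x then A / 2 else 0) ≤
      ∫ U, ‖toMat U x 0‖ ^ 2 * ‖toMat U y 0‖ ^ 2 ∂haar (m + 1) := by
    intro y
    by_cases hyx : y = x
    · subst hyx
      simp only [if_true, (partner_ne y).symm, if_false, ← pow_add]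
      simp only [Nat.reduceAdd, A]
      linarith
    by_cases hp : y = partner x
    · simp only [hp, partner_ne, if_true, if_false, add_zero, sub_self]
      exact integral_nonneg fun U => by positivity
    · simp [hyx, hp, integral_norm_sq_mul_norm_sq hyx hp, A]
  have h3 := Finset.sum_le_sum fun y (_ : y ∈ Finset.univ) => h2 y
  rw [h1, Finset.sum_sub_distrib, Finset.sum_add_distrib] at h3
  simp only [Finset.sum_const, Finset.card_univ, Fintype.card_pi, Fintype.card_fin,
    Finset.prod_const, nsmul_eq_mul, Finset.sum_ite_eq', Finset.mem_univ, if_true] at h3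
  push_cast at h3
  have hd : (0 : ℝ) < 2 ^ (m + 1) := by positivity
  rw [le_div_iff₀ hd] at h3
  rw [le_div_iff₀ (by positivity)]
  linarith

/-! ### Transfer to designs -/

lemma tensor_mul {ι : Type} [Fintype ι] {k : ℕ} (A B : Fin k → Matrix ι ι ℂ) :
    tensor A * tensor B = tensor fun i => A i * B i := by
  classical
  ext x y
  simp only [tensor, Matrix.mul_apply, Matrix.of_apply, ← Finset.prod_mul_distrib]
  rw [Finset.prod_univ_sum, Fintype.piFinset_univ]

/-- A design has the same moments as the Haar measure against products of two diagonal entries of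
matrices of the form `U A Uᴴ`. -/
lemma IsDesign.integral_eq {n : ℕ} {μ : Measure (SP n)} (h : IsDesign 2 μ)
    (A : Fin 2 → Matrix (Bits n) (Bits n) ℂ) (x : Bits n) (f : SP n → ℝ)
    (hf : ∀ U, ∏ i, (toMat U * A i * (toMat U)ᴴ) x x = (f U : ℂ)) :
    ∫ U, f U ∂μ = ∫ U, f U ∂haar n := by
  have key (U : SP n) : (tensorPow 2 (toMat U) * tensor A * tensorPow 2 (toMat U)ᴴ :
      Matrix (Fin 2 → Bits n) (Fin 2 → Bits n) ℂ) (fun _ => x) (fun _ => x) = (f U : ℂ) := by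
    rw [← hf U, tensorPow, tensorPow, tensor_mul, tensor_mul]
    rfl
  have h' := congrFun (congrFun (h.twirl_eq (tensor A)) fun _ => x) fun _ => x
  simp only [twirl, Matrix.of_apply, key, integral_complex_ofReal] at h'
  exact_mod_cast h'

lemma mul_single_mul_conjTranspose_apply {n : ℕ} (U : SP n) (x : Bits n) :
    (toMat U * Matrix.single 0 0 1 * (toMat U)ᴴ : Matrix (Bits n) (Bits n) ℂ) x x =
      (outputProb U x : ℂ) := by
  rw [Matrix.mul_apply, Finset.sum_eq_single 0]
  · simp [outputProb, Complex.mul_conj']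
  · intro j _ hj
    simp [hj]
  · simp

/-- The twirl of `|0⟩⟨0| ⊗ 1` computes the first moment. -/
lemma IsDesign.integral_outputProb {n : ℕ} {μ : Measure (SP n)} (h : IsDesign 2 μ) (x : Bits n) :
    ∫ U, outputProb U x ∂μ = ∫ U, outputProb U x ∂haar n := by
  refine h.integral_eq ![Matrix.single 0 0 1, 1] x _ fun U => ?_
  have h1 : toMat U * (toMat U)ᴴ = 1 := U.1.2.2
  simp [Fin.prod_univ_two, mul_single_mul_conjTranspose_apply, h1]

/-- The twirl of `|0⟩⟨0| ⊗ |0⟩⟨0|` computes the second moment. -/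
lemma IsDesign.integral_outputProb_sq {n : ℕ} {μ : Measure (SP n)} (h : IsDesign 2 μ)
    (x : Bits n) :
    ∫ U, outputProb U x ^ 2 ∂μ = ∫ U, outputProb U x ^ 2 ∂haar n := by
  refine h.integral_eq (fun _ => Matrix.single 0 0 1) x _ fun U => ?_
  simp [mul_single_mul_conjTranspose_apply]

/-! ### Anticoncentration -/

/-- A form of the Paley–Zygmund inequality for a variable with mean `1 / d` and second moment at
most `2 / d ^ 2`. -/
lemma paley_zygmund {Ω : Type*} [MeasurableSpace Ω] (μ : Measure Ω) [IsProbabilityMeasure μ]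
    {f : Ω → ℝ} (hm : Measurable f) (hf : Integrable f μ) (hf2 : Integrable (fun ω => f ω ^ 2) μ)
    {d α : ℝ} (hd : 0 < d) (hα0 : 0 ≤ α) (hα1 : α ≤ 1) (h1 : ∫ ω, f ω ∂μ = 1 / d)
    (h2 : ∫ ω, f ω ^ 2 ∂μ ≤ 2 / d ^ 2) :
    (1 - α) ^ 2 / 2 ≤ μ.real {ω | α / d ≤ f ω} := by
  -- `s` maximizes the resulting bound `2 s (1 - α) / d - 2 s² / d²`.
  set s : ℝ := (1 - α) * d / 2 with hs
  have hs0 : 0 ≤ s := by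
    have : 0 ≤ 1 - α := by linarith
    positivity
  have hE : MeasurableSet {ω | α / d ≤ f ω} := measurableSet_le measurable_const hm
  have hp (ω : Ω) : 2 * s * (f ω - α / d) - s ^ 2 * f ω ^ 2 ≤
      {ω | α / d ≤ f ω}.indicator (fun _ => (1 : ℝ)) ω := by
    by_cases hω : α / d ≤ f ω
    · have hsα : 0 ≤ 2 * s * (α / d) := by positivity
      rw [Set.indicator_of_mem (by exact hω)]
      nlinarith [sq_nonneg (s * f ω - 1)]
    · rw [Set.indicator_of_notMem (by exact hω)]
      nlinarith [mul_nonneg hs0 (sub_nonneg.2 (not_le.1 hω).le), sq_nonneg (s * f ω)]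
  have hi : Integrable (fun ω => 2 * s * (f ω - α / d)) μ :=
    (hf.sub (integrable_const _)).const_mul _
  have h := integral_mono (hi.sub (hf2.const_mul (s ^ 2)))
    ((integrable_const (1 : ℝ)).indicator hE) hp
  rw [integral_indicator_const _ hE, smul_eq_mul, mul_one] at h
  refine le_trans ?_ h
  have hsub : ∫ ω, (f ω - α / d) ∂μ = 1 / d - α / d := by
    rw [integral_sub hf (integrable_const _), h1]
    simp
  simp only [Pi.sub_apply]
  rw [integral_sub hi (hf2.const_mul _), integral_const_mul, integral_const_mul, hsub]
  have h3 := mul_le_mul_of_nonneg_left h2 (sq_nonneg s)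
  have h4 : (1 - α) ^ 2 / 2 = 2 * s * (1 / d - α / d) - s ^ 2 * (2 / d ^ 2) := by
    rw [hs]
    field_simp
    ring
  linarith

lemma continuous_outputProb {n : ℕ} (x : Bits n) :
    Continuous fun U : SP n => outputProb U x :=
  (continuous_toMat_apply x 0).norm.pow 2

lemma integral_outputProb_sq_haar_le {m : ℕ} (x : Bits (m + 1)) :
    ∫ U, outputProb U x ^ 2 ∂haar (m + 1) ≤ 2 / (2 ^ (m + 1)) ^ 2 := by
  simpa only [outputProb, ← pow_mul] using integral_norm_pow_four_le x

end SymplecticCircuits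

theorem theorem5 (n : ℕ) (hn : 1 ≤ n)
    (μ : MeasureTheory.Measure (SymplecticCircuits.SP n))
    (hμ : μ = SymplecticCircuits.haar n ∨ SymplecticCircuits.IsDesign 2 μ)
    (x : SymplecticCircuits.Bits n) (α : ℝ) (hα0 : 0 ≤ α) (hα1 : α ≤ 1) :
    (1 - α) ^ 2 / 2 ≤
      μ.real {U | α / (2 : ℝ) ^ n ≤ SymplecticCircuits.outputProb U x} := by
  obtain ⟨m, rfl⟩ : ∃ m, n = m + 1 := ⟨n - 1, by omega⟩
  have hc := SymplecticCircuits.continuous_outputProb x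
  have h : MeasureTheory.IsProbabilityMeasure μ ∧
      ∫ U, SymplecticCircuits.outputProb U x ∂μ = 1 / 2 ^ (m + 1) ∧
      ∫ U, SymplecticCircuits.outputProb U x ^ 2 ∂μ ≤ 2 / (2 ^ (m + 1)) ^ 2 := by
    rcases hμ with rfl | hμ
    · exact ⟨inferInstance, SymplecticCircuits.integral_norm_sq x,
        SymplecticCircuits.integral_outputProb_sq_haar_le x⟩
    · exact ⟨hμ.isProbabilityMeasure,
        (hμ.integral_outputProb x).trans (SymplecticCircuits.integral_norm_sq x),
        (hμ.integral_outputProb_sq x).trans_le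
          (SymplecticCircuits.integral_outputProb_sq_haar_le x)⟩
  obtain ⟨_, h1, h2⟩ := h
  exact SymplecticCircuits.paley_zygmund μ hc.measurable
    (SymplecticCircuits.integrable_of_continuous μ hc)
    (SymplecticCircuits.integrable_of_continuous μ (hc.pow 2)) (by positivity) hα0 hα1 h1 h2
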